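/- All matrices are complex. For $n\times n$ matrices $A,B$ let $X_A$ and $\Delta_B$ be the endomorphisms $X_A(M)=AM$ and $\Delta_B(M)=B\circ M$ (entrywise product) of $\mathrm{Mat}_n(\mathbb C)$. The pair $(A,B)$ is a one-sided Jones pair if $X_A$ and $\Delta_B$ are invertible and $X_A\Delta_BX_A=\Delta_BX_A\Delta_B$; it is a Jones pair if both $(A,B)$ and $(A,B^T)$ are one-sided Jones pairs, and it is an invertible Jones pair if in addition $A$ has no zero entry and $B$ is an invertible matrix. Let $\mathcal N_{A,B}$ be the space of all $n\times n$ matrices $M$ such that each of the vectors $Ae_i\circ Be_j$ $(1\le i,j\le n)$ is an eigenvector of $M$; the dimension of a Jones pair $(A,B)$ is $\dim\mathcal N_{A,B}$. A symmetric $(n,k,\lambda)$-design consists of $n$ points and $n$ blocks, with $0<k<n$, such that each block contains exactly $k$ points, each point lies on exactly $k$ blocks, and any two distinct points lie together on exactly $\lambda$ blocks (so the trivial designs with $k=1$ or $k=n-1$ are allowed). Its incidence matrix is the $n\times n$ $01$-matrix with rows indexed by points and columns by blocks. Lemma. If $(A,B)$ is an $n\times n$ invertible Jones pair of dimension two, then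 there are scalars $a,b\in\mathbb C$ and the incidence matrix $N$ of a symmetric $(n,k,\lambda)$-design, for some integers $k,\lambda\ge 0$, such that $$B=a(J-N)+bN,$$ where $J$ is the $n\times n$ all-ones matrix. -/

import Mathlib

open Matrix

namespace JonesPair

variable {n : ℕ}

/-- The endomorphism `X_A : M ↦ A M` of `Mat_n(ℂ)`. -/
def X (A : Matrix (Fin n) (Fin n) ℂ) : Module.End ℂ (Matrix (Fin n) (Fin n) ℂ) where
  toFun M := A * M
  map_add' M M' := Matrix.mul_add A M M'
  map_smul' c M := by simp

/-- The endomorphism `Δ_B : M ↦ B ∘ M` (entrywise product) of `Mat_n(ℂ)`. -/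
def Delta (B : Matrix (Fin n) (Fin n) ℂ) : Module.End ℂ (Matrix (Fin n) (Fin n) ℂ) where
  toFun M := B ⊙ M
  map_add' M M' := Matrix.hadamard_add B M M'
  map_smul' c M := by simp

/-- `(A, B)` is a one-sided Jones pair: `X_A` and `Δ_B` are invertible and
`X_A Δ_B X_A = Δ_B X_A Δ_B`. -/
def IsOneSidedJonesPair (A B : Matrix (Fin n) (Fin n) ℂ) : Prop :=
  IsUnit (X A) ∧ IsUnit (Delta B) ∧ X A * Delta B * X A = Delta B * X A * Delta B

/-- `(A, B)` is a Jones pair: both `(A, B)` and `(A, Bᵀ)` are one-sided Jones pairs. -/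
def IsJonesPair (A B : Matrix (Fin n) (Fin n) ℂ) : Prop :=
  IsOneSidedJonesPair A B ∧ IsOneSidedJonesPair A Bᵀ

/-- A Jones pair `(A, B)` is invertible if `A` is Schur-invertible (has no zero entry) and `B` is
an invertible matrix. -/
def IsInvertibleJonesPair (A B : Matrix (Fin n) (Fin n) ℂ) : Prop :=
  IsJonesPair A B ∧ (∀ i j, A i j ≠ 0) ∧ IsUnit B

/-- The vector `A e_i ∘ B e_j`: the entrywise product of column `i` of `A` and column `j` of `B`. -/
def colProd (A B : Matrix (Fin n) (Fin n) ℂ) (i j : Fin n) : Fin n → ℂ :=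
  fun r => A r i * B r j

/-- `N_{A,B}`: the space of matrices `M` that have every `A e_i ∘ B e_j` as an eigenvector.
(For a Jones pair all these vectors are nonzero, as `A` is invertible and `B` has no zero entry.) -/
def nomura (A B : Matrix (Fin n) (Fin n) ℂ) : Submodule ℂ (Matrix (Fin n) (Fin n) ℂ) where
  carrier := {M | ∀ i j, ∃ θ : ℂ, M *ᵥ colProd A B i j = θ • colProd A B i j}
  zero_mem' := fun i j => ⟨0, by simp⟩
  add_mem' := by
    intro M M' hM hM' i j
    obtain ⟨θ, h⟩ := hM i j
    obtain ⟨θ', h'⟩ := hM' i j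
    exact ⟨θ + θ', by rw [Matrix.add_mulVec, h, h', add_smul]⟩
  smul_mem' := by
    intro c M hM i j
    obtain ⟨θ, h⟩ := hM i j
    exact ⟨c * θ, by rw [Matrix.smul_mulVec, h, smul_smul]⟩

/-- The dimension of a Jones pair `(A, B)` is `dim N_{A,B}`. -/
noncomputable def dimension (A B : Matrix (Fin n) (Fin n) ℂ) : ℕ :=
  Module.finrank ℂ (nomura A B)

/-- A symmetric `(v, k, lam)`-design with point set `P` and block set `Q`: there are `v` points and
`v` blocks, every block contains exactly `k` points and every point lies on exactly `k` blocks with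
`0 < k < v`, and any two distinct points lie together on exactly `lam` blocks.
The trivial designs with `k = 1` or `k = v - 1` are included. -/
structure SymmetricDesign (P Q : Type*) (v k lam : ℕ) where
  inc : P → Q → Prop
  card_points : Nat.card P = v
  card_blocks : Nat.card Q = v
  pos : 0 < k
  lt : k < v
  block_size : ∀ q, {p | inc p q}.ncard = k
  replication : ∀ p, {q | inc p q}.ncard = k
  balance : ∀ p p', p ≠ p' → {q | inc p q ∧ inc p' q}.ncard = lam

open Classical in
/-- The incidence matrix: rows are points, columns are blocks. -/
noncomputable def SymmetricDesign.incMatrix {P Q : Type*} {v k lam : ℕ}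
    (D : SymmetricDesign P Q v k lam) : Matrix P Q ℂ :=
  Matrix.of fun p q => if D.inc p q then 1 else 0

/-- The all-ones matrix `J`. -/
def allOnes (n : ℕ) : Matrix (Fin n) (Fin n) ℂ :=
  Matrix.of fun _ _ => 1

end JonesPair

namespace JonesPair

variable {n : ℕ} {A B : Matrix (Fin n) (Fin n) ℂ}

/-! Entrywise, the braid relation says that `A` has eigenvalue `B i j` on `colProd A B i j`. In
dimension two, `1` and `A` span `nomura A B`, which also contains `A * A`; so `A * A` is a
combination of them and the entries of `B` take at most two values (`exists_quadratic`). Columns of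
`B` and of `Bᵀ` all sum to `A.trace` (`sum_col`), which makes block sizes and replication numbers
one constant `k`. Invertibility of `B` makes `Bᵀ` type II (`sum_div_eq_zero`), which fixes how many
blocks two points share. -/

lemma IsOneSidedJonesPair.isUnit (h : IsOneSidedJonesPair A B) : IsUnit A := by
  obtain ⟨M, hM⟩ := ((Module.End.isUnit_iff _).1 h.1).surjective 1
  exact IsUnit.of_mul_eq_one M hM

lemma IsOneSidedJonesPair.ne_zero (h : IsOneSidedJonesPair A B) (i j : Fin n) : B i j ≠ 0 := by
  intro h0
  have hz : Delta B (Matrix.single i j 1) = Delta B 0 := by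
    ext r s
    by_cases hrs : i = r ∧ j = s
    · obtain ⟨rfl, rfl⟩ := hrs
      simp [Delta, h0]
    · simp [Delta, Matrix.single, hrs]
  have := congrFun₂ (((Module.End.isUnit_iff _).1 h.2.1).injective hz) i j
  simp at this

/-- The defining relation of a one-sided Jones pair in terms of the entries. -/
lemma IsOneSidedJonesPair.sum_eq (h : IsOneSidedJonesPair A B) (s i j : Fin n) :
    ∑ r, A s r * (B r j * A r i) = B s j * (A s i * B i j) := by
  have h' := congrFun₂ (LinearMap.congr_fun h.2.2 (Matrix.single i j 1)) s j
  have e : B ⊙ Matrix.single i j 1 = Matrix.single i j (B i j) := by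
    ext r t
    by_cases hrs : i = r ∧ j = t
    · obtain ⟨rfl, rfl⟩ := hrs
      simp
    · simp [Matrix.single, hrs]
  simp only [Module.End.mul_apply, X, Delta, LinearMap.coe_mk, AddHom.coe_mk, e] at h'
  simpa [Matrix.mul_apply, Matrix.hadamard_apply, Matrix.single_apply] using h'

/-- `A` and the diagonal matrix of each column of `B` satisfy the braid relation. -/
lemma IsOneSidedJonesPair.braid (h : IsOneSidedJonesPair A B) (j : Fin n) :
    A * diagonal (B.col j) * A = diagonal (B.col j) * A * diagonal (B.col j) := by
  ext s i
  have := h.sum_eq s i j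
  rw [Matrix.mul_diagonal, Matrix.diagonal_mul, Matrix.mul_assoc, Matrix.mul_apply]
  simpa [Matrix.diagonal_mul, mul_assoc] using this

lemma IsOneSidedJonesPair.mulVec_colProd (h : IsOneSidedJonesPair A B) (i j : Fin n) :
    A *ᵥ colProd A B i j = B i j • colProd A B i j := by
  ext s
  have := h.sum_eq s i j
  simp only [Matrix.mulVec, dotProduct, colProd, Pi.smul_apply, smul_eq_mul]
  calc _ = ∑ r, A s r * (B r j * A r i) := by simp only [mul_comm]
    _ = _ := by rw [this]; ring

lemma IsOneSidedJonesPair.colProd_ne_zero (h : IsOneSidedJonesPair A B)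
    (hA : ∀ i j, A i j ≠ 0) (i j : Fin n) : colProd A B i j ≠ 0 := fun h0 =>
  mul_ne_zero (hA i i) (h.ne_zero i j) (congrFun h0 i)

lemma IsOneSidedJonesPair.diagonal_mul_inv (h : IsOneSidedJonesPair A B) (j : Fin n) :
    diagonal (B.col j) * diagonal (fun r => (B r j)⁻¹) = 1 := by
  rw [Matrix.diagonal_mul_diagonal, ← Matrix.diagonal_one]
  congr 1
  ext r
  exact mul_inv_cancel₀ (h.ne_zero r j)

lemma IsOneSidedJonesPair.inv_mul_diagonal (h : IsOneSidedJonesPair A B) (j : Fin n) :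
    diagonal (fun r => (B r j)⁻¹) * diagonal (B.col j) = 1 :=
  mul_eq_one_comm.1 (h.diagonal_mul_inv j)

lemma IsOneSidedJonesPair.mul_inv_cancel (h : IsOneSidedJonesPair A B) : A * A⁻¹ = 1 :=
  Matrix.mul_nonsing_inv _ ((Matrix.isUnit_iff_isUnit_det _).1 h.isUnit)

lemma IsOneSidedJonesPair.inv_mul_cancel (h : IsOneSidedJonesPair A B) : A⁻¹ * A = 1 :=
  Matrix.nonsing_inv_mul _ ((Matrix.isUnit_iff_isUnit_det _).1 h.isUnit)

/-- The braid relation solved for a conjugate: traces of this identity give column sums, diagonal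
entries give the type II property. -/
lemma IsOneSidedJonesPair.conj_diagonal (h : IsOneSidedJonesPair A B) (j : Fin n) :
    A * diagonal (B.col j) * A⁻¹ = diagonal (fun r => (B r j)⁻¹) * A * diagonal (B.col j) := by
  have h1 := h.mul_inv_cancel
  have h2 := h.inv_mul_diagonal j
  have h3 := h.braid j
  calc _ = diagonal (fun r => (B r j)⁻¹) * (diagonal (B.col j) * A * diagonal (B.col j)) * A⁻¹ := by
        simp only [← Matrix.mul_assoc, h2, Matrix.one_mul]
    _ = _ := by rw [← h3]; simp only [Matrix.mul_assoc, h1, Matrix.mul_one]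

lemma IsOneSidedJonesPair.inv_conj_diagonal (h : IsOneSidedJonesPair A B) (j : Fin n) :
    A⁻¹ * diagonal (B.col j) * A = diagonal (B.col j) * A * diagonal (fun r => (B r j)⁻¹) := by
  have h1 := h.inv_mul_cancel
  have h2 := h.diagonal_mul_inv j
  have h3 := h.braid j
  calc _ = A⁻¹ * (diagonal (B.col j) * A * diagonal (B.col j)) * diagonal (fun r => (B r j)⁻¹) := by
        simp only [Matrix.mul_assoc, h2, Matrix.mul_one]
    _ = _ := by rw [← h3]; simp only [← Matrix.mul_assoc, h1, Matrix.one_mul]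

/-- Every column of `B` has sum `tr A`. -/
lemma IsOneSidedJonesPair.sum_col (h : IsOneSidedJonesPair A B) (j : Fin n) :
    ∑ r, B r j = A.trace := by
  have h1 := congrArg Matrix.trace (h.conj_diagonal j)
  rw [Matrix.trace_mul_cycle, h.inv_mul_cancel, Matrix.one_mul, Matrix.trace_mul_cycle,
    h.diagonal_mul_inv, Matrix.one_mul, Matrix.trace_diagonal] at h1
  exact h1

/-! ### Type II properties -/

/-- If `(A, B)` is a one-sided Jones pair with `B` invertible, then `A` is a type II matrix. -/
lemma IsOneSidedJonesPair.mul_inv_apply (h : IsOneSidedJonesPair A B) (hB : IsUnit B)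
    (i r : Fin n) : A i r * A⁻¹ r i = (n : ℂ)⁻¹ := by
  let f : Fin n → Fin n → ℂ := fun i r => A i r * A⁻¹ r i
  have hBB : B * B⁻¹ = 1 := Matrix.mul_nonsing_inv _ ((Matrix.isUnit_iff_isUnit_det _).1 hB)
  have h1 (i) : f i ᵥ* B = A i i • (1 : Fin n → ℂ) := by
    ext j
    have := congrFun₂ (h.conj_diagonal j) i i
    rw [Matrix.mul_apply, Matrix.mul_diagonal, Matrix.diagonal_mul] at this
    simp only [Matrix.mul_diagonal, Matrix.col_apply] at this
    have hb := h.ne_zero i j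
    simp only [Matrix.vecMul, dotProduct, f, Pi.smul_apply, Pi.one_apply, smul_eq_mul, mul_one]
    calc _ = ∑ r, A i r * B r j * A⁻¹ r i := Finset.sum_congr rfl fun r _ => by ring
      _ = _ := by rw [this]; field_simp
  have h2 (i) : (fun r => f r i) ᵥ* B = A i i • (1 : Fin n → ℂ) := by
    ext j
    have := congrFun₂ (h.inv_conj_diagonal j) i i
    rw [Matrix.mul_apply, Matrix.mul_diagonal, Matrix.diagonal_mul] at this
    simp only [Matrix.mul_diagonal, Matrix.col_apply] at this
    have hb := h.ne_zero i j
    simp only [Matrix.vecMul, dotProduct, f, Pi.smul_apply, Pi.one_apply, smul_eq_mul, mul_one]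
    calc _ = ∑ r, A⁻¹ i r * B r j * A r i := Finset.sum_congr rfl fun r _ => by ring
      _ = _ := by rw [this]; field_simp
  have cancel {v w : Fin n → ℂ} (e : v ᵥ* B = w) : v = w ᵥ* B⁻¹ := by
    rw [← e, Matrix.vecMul_vecMul, hBB, Matrix.vecMul_one]
  -- All rows of `f` are multiples of one vector. Row sums 1 force equal diagonal entries of `A`,
  -- hence equal rows; with symmetry `f` is constant.
  have hf (i) : f i = A i i • ((1 : Fin n → ℂ) ᵥ* B⁻¹) := by
    rw [cancel (h1 i), Matrix.smul_vecMul]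
  have hsymm (i r) : f i r = f r i :=
    congrFun ((cancel (h1 i)).trans (cancel (h2 i)).symm) r
  have hsum (i) : ∑ r, f i r = 1 := by
    have := congrFun₂ h.mul_inv_cancel i i
    rwa [Matrix.mul_apply, Matrix.one_apply_eq] at this
  set c := (1 : Fin n → ℂ) ᵥ* B⁻¹
  have hA (i) : A i i * ∑ r, c r = 1 := by
    rw [← hsum i, hf i, Finset.mul_sum]
    rfl
  have hrow (i k) : f i = f k := by
    have hS : ∑ r, c r ≠ 0 := right_ne_zero_of_mul_eq_one (hA i)
    rw [hf, hf, mul_right_cancel₀ hS ((hA i).trans (hA k).symm)]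
  have hconst (s) : f i s = f i r := by
    rw [hsymm i s, hrow s r, hsymm r i]
  have := hsum i
  simp only [hconst, Finset.sum_const, Finset.card_univ, Fintype.card_fin, nsmul_eq_mul] at this
  exact eq_inv_of_mul_eq_one_right this

/-- If `(A, B)` is a one-sided Jones pair with `B` invertible, then `B` is a type II matrix. -/
lemma IsOneSidedJonesPair.sum_div_eq_zero (h : IsOneSidedJonesPair A B) (hB : IsUnit B)
    {i j : Fin n} (hij : i ≠ j) : ∑ r, B r j * (B r i)⁻¹ = 0 := by
  by_contra ht
  -- `W` intertwines the diagonal matrices of columns `j` and `i`. As `A` is type II, its diagonal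
  -- entries all equal the sum over `n`; were that nonzero, the two columns would agree.
  let W := A⁻¹ * diagonal (fun r => B r j * (B r i)⁻¹) * A
  have hdiag : diagonal (fun r => B r j * (B r i)⁻¹) =
      diagonal (fun r => (B r i)⁻¹) * diagonal (B.col j) := by
    rw [Matrix.diagonal_mul_diagonal]
    congr 1
    ext r
    exact mul_comm _ _
  have hW : W * diagonal (B.col j) = diagonal (B.col i) * W := by
    have e1 := h.conj_diagonal i
    have e2 := h.inv_mul_cancel
    calc W * diagonal (B.col j)
        = A⁻¹ * diagonal (fun r => (B r i)⁻¹) *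
            (diagonal (B.col j) * A * diagonal (B.col j)) := by
          simp only [W, hdiag, Matrix.mul_assoc]
      _ = A⁻¹ * (diagonal (fun r => (B r i)⁻¹) * A * diagonal (B.col i)) *
            diagonal (fun r => (B r i)⁻¹) * diagonal (B.col j) * A := by
          rw [← h.braid j]
          simp only [Matrix.mul_assoc]
          rw [← Matrix.mul_assoc (diagonal (B.col i)), h.diagonal_mul_inv, Matrix.one_mul]
      _ = diagonal (B.col i) * W := by
          rw [← e1]
          simp only [W, hdiag, ← Matrix.mul_assoc, e2, Matrix.one_mul]
  have hWr (r) : W r r = (n : ℂ)⁻¹ * ∑ r, B r j * (B r i)⁻¹ := by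
    simp only [W, Matrix.mul_apply (M := A⁻¹ * _), Matrix.mul_diagonal, Finset.mul_sum]
    refine Finset.sum_congr rfl fun s _ => ?_
    rw [← h.mul_inv_apply hB s r]
    ring
  have hn : (n : ℂ) ≠ 0 := by
    have := i.pos
    exact_mod_cast this.ne'
  have hcol (r) : B r j = B r i := by
    have := congrFun₂ hW r r
    rw [Matrix.mul_diagonal, Matrix.diagonal_mul, mul_comm] at this
    exact mul_right_cancel₀ (by rw [hWr]; exact mul_ne_zero (inv_ne_zero hn) ht) this
  exact ((Matrix.isUnit_iff_isUnit_det _).1 hB).ne_zero (Matrix.det_zero_of_column_eq hij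
    fun r => (hcol r).symm)

/-! ### Dimension two -/

/-- The entries of `B` are roots of a monic quadratic when the pair has dimension two. -/
lemma IsOneSidedJonesPair.exists_quadratic (h : IsOneSidedJonesPair A B)
    (hA : ∀ i j, A i j ≠ 0) (hn : 2 ≤ n) (hdim : dimension A B = 2) :
    ∃ x y : ℂ, ∀ i j, B i j ^ 2 = x + y * B i j := by
  have h1 : (1 : Matrix (Fin n) (Fin n) ℂ) ∈ nomura A B := fun i j => ⟨1, by simp⟩
  have hAm : A ∈ nomura A B := fun i j => ⟨_, h.mulVec_colProd i j⟩
  have hsq (i j) : (A * A) *ᵥ colProd A B i j = (B i j ^ 2) • colProd A B i j := by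
    rw [← Matrix.mulVec_mulVec, h.mulVec_colProd, Matrix.mulVec_smul, h.mulVec_colProd,
      smul_smul, sq]
  have hAA : A * A ∈ nomura A B := fun i j => ⟨_, hsq i j⟩
  let v : Fin 2 → nomura A B := ![⟨1, h1⟩, ⟨A, hAm⟩]
  have hv : LinearIndependent ℂ v := by
    rw [LinearIndependent.pair_iff]
    intro s t hst
    have hst' : s • (1 : Matrix (Fin n) (Fin n) ℂ) + t • A = 0 := congrArg Subtype.val hst
    have ht : t = 0 := by
      have := congrFun₂ hst' ⟨0, by omega⟩ ⟨1, by omega⟩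
      simpa [hA] using this
    refine ⟨?_, ht⟩
    have := congrFun₂ hst' ⟨0, by omega⟩ ⟨0, by omega⟩
    simpa [ht] using this
  have hspan : Submodule.span ℂ (Set.range v) = ⊤ :=
    hv.span_eq_top_of_card_eq_finrank (by rw [Fintype.card_fin]; exact hdim.symm)
  have hmem : (⟨A * A, hAA⟩ : nomura A B) ∈ Submodule.span ℂ (Set.range v) :=
    hspan ▸ Submodule.mem_top
  simp only [v, Matrix.range_cons, Matrix.range_empty, Set.union_empty, Set.singleton_union,
    Submodule.mem_span_pair] at hmem
  obtain ⟨x, y, hxy⟩ := hmem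
  have hxy' : x • (1 : Matrix (Fin n) (Fin n) ℂ) + y • A = A * A := congrArg Subtype.val hxy
  refine ⟨x, y, fun i j => ?_⟩
  have e := hsq i j
  rw [← hxy', Matrix.add_mulVec, Matrix.smul_mulVec, Matrix.smul_mulVec, Matrix.one_mulVec,
    h.mulVec_colProd, smul_smul, ← add_smul] at e
  exact (smul_left_injective ℂ (h.colProd_ne_zero hA i j) e).symm

lemma two_le_of_dimension_eq_two (hdim : dimension A B = 2) : 2 ≤ n := by
  have h : dimension A B ≤ n * n := by
    refine (Submodule.finrank_le _).trans ?_
    rw [Module.finrank_matrix]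
    simp
  by_contra hn
  have : n = 0 ∨ n = 1 := by omega
  rcases this with rfl | rfl <;> omega

lemma exists_ne_of_isUnit (hB : IsUnit B) (hn : 2 ≤ n) (b : ℂ) : ∃ i j, B i j ≠ b := by
  by_contra! hb
  refine ((Matrix.isUnit_iff_isUnit_det _).1 hB).ne_zero (Matrix.det_zero_of_row_eq
    (i := ⟨0, by omega⟩) (j := ⟨1, by omega⟩) (by simp) ?_)
  ext j
  rw [hb, hb]

/-! ### Counting with two values -/

open Classical in
/-- A sum over a family with values in `{a, b}` determines how often the value `b` occurs. -/
lemma sum_eq_of_two_valued {a b : ℂ} {f : Fin n → ℂ} (hf : ∀ r, f r = a ∨ f r = b) :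
    ∑ r, f r = n * a + (b - a) * ({r | f r = b}.ncard : ℂ) := by
  have e (r) : f r = a + (b - a) * if f r = b then 1 else 0 := by
    split_ifs with hb
    · rw [hb]; ring
    · simpa using (hf r).resolve_right hb
  rw [Finset.sum_congr rfl fun r _ => e r, Finset.sum_add_distrib, ← Finset.mul_sum,
    Finset.sum_boole, Set.ncard_eq_toFinset_card']
  simp

-- Each term is expanded in indicators of the value `b`; the factor `a * b` clears the denominators
-- of the possible ratios `1`, `a / b`, `b / a`.
open Classical in
lemma sum_mul_inv_of_two_valued {a b : ℂ} (ha : a ≠ 0) (hb : b ≠ 0) (hab : a ≠ b)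
    {f g : Fin n → ℂ} (hf : ∀ r, f r = a ∨ f r = b) (hg : ∀ r, g r = a ∨ g r = b) :
    a * b * ∑ r, f r * (g r)⁻¹ = n * (a * b) + b * (b - a) * ({r | f r = b}.ncard : ℂ)
      + a * (a - b) * ({r | g r = b}.ncard : ℂ)
      - (b - a) ^ 2 * ({r | g r = b ∧ f r = b}.ncard : ℂ) := by
  have e (r) : a * b * (f r * (g r)⁻¹) = a * b + b * (b - a) * (if f r = b then 1 else 0)
      + a * (a - b) * (if g r = b then 1 else 0)
      - (b - a) ^ 2 * (if g r = b ∧ f r = b then 1 else 0) := by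
    rcases hf r with h1 | h1 <;> rcases hg r with h2 | h2 <;> simp [h1, h2, hab] <;>
      field_simp <;> ring
  rw [Finset.mul_sum, Finset.sum_congr rfl fun r _ => e r, Finset.sum_sub_distrib,
    Finset.sum_add_distrib, Finset.sum_add_distrib, Finset.sum_const, ← Finset.mul_sum,
    ← Finset.mul_sum, ← Finset.mul_sum, Finset.sum_boole, Finset.sum_boole, Finset.sum_boole,
    Set.ncard_eq_toFinset_card', Set.ncard_eq_toFinset_card', Set.ncard_eq_toFinset_card']
  simp

end JonesPair

open JonesPair in
theorem mainTheorem10 (n : ℕ) (A B : Matrix (Fin n) (Fin n) ℂ)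
    (hAB : JonesPair.IsInvertibleJonesPair A B)
    (hdim : JonesPair.dimension A B = 2) :
    ∃ (k lam : ℕ) (D : JonesPair.SymmetricDesign (Fin n) (Fin n) n k lam) (a b : ℂ),
      B = a • (JonesPair.allOnes n - D.incMatrix) + b • D.incMatrix := by
  obtain ⟨⟨h, hT⟩, hA, hB⟩ := hAB
  have hn := two_le_of_dimension_eq_two hdim
  have hBT : IsUnit Bᵀ := (Matrix.isUnit_transpose _).2 hB
  obtain ⟨x, y, hxy⟩ := h.exists_quadratic hA hn hdim
  let p₀ : Fin n := ⟨0, by omega⟩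
  let p₁ : Fin n := ⟨1, by omega⟩
  have hp : p₀ ≠ p₁ := by simp [p₀, p₁]
  -- Both values are actual entries: block `p₀` contains `p₀`, so `0 < k`, and block `w` omits `u`,
  -- so `k < n`.
  obtain ⟨b, hb⟩ : ∃ b, b = B p₀ p₀ := ⟨_, rfl⟩
  obtain ⟨u, w, huw⟩ := exists_ne_of_isUnit hB hn b
  obtain ⟨a, ha⟩ : ∃ a, a = B u w := ⟨_, rfl⟩
  rw [← ha] at huw
  have ha0 : a ≠ 0 := ha ▸ h.ne_zero u w
  have hb0 : b ≠ 0 := hb ▸ h.ne_zero p₀ p₀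
  have hba : b - a ≠ 0 := sub_ne_zero.2 huw.symm
  have htwo (i j) : B i j = a ∨ B i j = b := by
    have e1 := hxy i j
    have e2 := hxy u w
    have e3 := hxy p₀ p₀
    rw [← ha] at e2
    rw [← hb] at e3
    have hy : y = a + b := mul_left_cancel₀ hba (by linear_combination e2 - e3)
    have : (B i j - a) * (B i j - b) = 0 := by
      subst hy
      linear_combination e1 - e2
    rcases mul_eq_zero.1 this with h' | h'
    · exact .inl (sub_eq_zero.1 h')
    · exact .inr (sub_eq_zero.1 h')
  obtain ⟨k, hk⟩ : ∃ k, k = {r | B r p₀ = b}.ncard := ⟨_, rfl⟩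
  have hblock (q) : {r | B r q = b}.ncard = k := by
    have e := (h.sum_col q).trans (h.sum_col p₀).symm
    rw [sum_eq_of_two_valued fun r => htwo r q, sum_eq_of_two_valued fun r => htwo r p₀,
      ← hk] at e
    exact_mod_cast mul_left_cancel₀ hba (add_left_cancel e)
  have hrep (p) : {r | B p r = b}.ncard = k := by
    -- Row sums and column sums agree because both pairs share the same `A`.
    have e := (hT.sum_col p).trans (h.sum_col p₀).symm
    simp only [Matrix.transpose_apply] at e
    rw [sum_eq_of_two_valued fun r => htwo p r, sum_eq_of_two_valued fun r => htwo r p₀,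
      ← hk] at e
    exact_mod_cast mul_left_cancel₀ hba (add_left_cancel e)
  have hinter {p p' : Fin n} (hpp : p ≠ p') :
      (b - a) ^ 2 * ({q | B p q = b ∧ B p' q = b}.ncard : ℂ) =
        n * (a * b) + b * (b - a) * k + a * (a - b) * k := by
    -- The vanishing ratio sum leaves an expression in `n`, `a`, `b`, `k` alone, so the count is the
    -- same for every pair of points.
    have e := hT.sum_div_eq_zero hBT hpp
    simp only [Matrix.transpose_apply] at e
    have e' := sum_mul_inv_of_two_valued ha0 hb0 huw (htwo p') (htwo p)
    rw [e, hrep, hrep] at e'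
    linear_combination e'
  let D : SymmetricDesign (Fin n) (Fin n) n k {q | B p₀ q = b ∧ B p₁ q = b}.ncard :=
    { inc := fun p q => B p q = b
      card_points := Nat.card_fin n
      card_blocks := Nat.card_fin n
      pos := by
        rw [hk]
        exact (Set.ncard_pos (Set.toFinite _)).2 ⟨p₀, hb.symm⟩
      lt := by
        rw [← hblock w]
        have := Set.ncard_lt_card (s := {r | B r w = b}) fun hs =>
          huw (ha.trans (Set.eq_univ_iff_forall.1 hs u))
        rwa [Nat.card_fin] at this
      block_size := hblock
      replication := hrep
      balance := fun p p' hpp => by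
        exact_mod_cast mul_left_cancel₀ (pow_ne_zero 2 hba) ((hinter hpp).trans (hinter hp).symm) }
  refine ⟨_, _, D, a, b, ?_⟩
  ext i j
  by_cases hij : B i j = b
  · simp [SymmetricDesign.incMatrix, allOnes, D, hij]
  · simpa [SymmetricDesign.incMatrix, allOnes, D, hij] using (htwo i j).resolve_right hij
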